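/- For a finite group $G$, let $D(G)$ be the Drinfel'd double of $G$ over $\mathbb{C}$: the Hopf algebra with basis $e_g\otimes x$ ($g,x\in G$), product $(e_g\otimes x)(e_h\otimes y)=\delta_{g,\,xhx^{-1}}\,e_g\otimes xy$, unit $\sum_g e_g\otimes 1$, comultiplication $\Delta(e_g\otimes x)=\sum_{ab=g}(e_a\otimes x)\otimes(e_b\otimes x)$ and counit $\varepsilon(e_g\otimes x)=\delta_{g,1}$. Let $\Lambda=|G|^{-1}\sum_{x\in G}e_1\otimes x$ be its normalized integral. For $n\ge 1$ put $\Lambda^{[n]}=\Lambda_1\Lambda_2\cdots\Lambda_n$ (Sweedler notation), and for an irreducible representation $V$ of $D(G)$ with character $\chi_V$ let $\nu_n(V)=\chi_V(\Lambda^{[n]})$ be the $n$-th Frobenius–Schur indicator of $V$. The finite group $G$ is called an $FSZ$-group if $\nu_n(V)\in\mathbb{Z}$ for every integer $n\ge 1$ and every irreducible representation $V$ of $D(G)$. Corollary. For every $N\ge 0$ the alternating group $A_N$ is an $FSZ$-group. -/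

import Mathlib

open scoped TensorProduct

/-! ### Higher Frobenius-Schur indicators of a finite-dimensional Hopf algebra -/

section Hopf

variable {H : Type*} [Ring H] [HopfAlgebra ℂ H]

/-- The Sweedler power `h ↦ h^{[n]} = h₁ h₂ ⋯ hₙ` (with `h^{[0]} = ε(h) 1`):
`h^{[n+1]} = (h₁)^{[n]} h₂`. -/
noncomputable def sweedlerPow (H : Type*) [Ring H] [HopfAlgebra ℂ H] : ℕ → (H →ₗ[ℂ] H)
  | 0 => Algebra.linearMap ℂ H ∘ₗ Coalgebra.counit
  | n + 1 => LinearMap.mul' ℂ H ∘ₗ (sweedlerPow H n).rTensor H ∘ₗ Coalgebra.comul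

/-- `Λ` is a normalized (two-sided) integral of the Hopf algebra `H`. -/
structure IsNormalizedIntegral (Λ : H) : Prop where
  mul_left : ∀ h : H, h * Λ = (Coalgebra.counit h : ℂ) • Λ
  mul_right : ∀ h : H, Λ * h = (Coalgebra.counit h : ℂ) • Λ
  counit_eq_one : (Coalgebra.counit Λ : ℂ) = 1

/-- A normalized integral is unique. -/
theorem IsNormalizedIntegral.unique {Λ Λ' : H} (h : IsNormalizedIntegral Λ)
    (h' : IsNormalizedIntegral Λ') : Λ = Λ' := by
  have h1 := h'.mul_left Λ
  have h2 := h.mul_right Λ'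
  rw [h.counit_eq_one, one_smul] at h1
  rw [h'.counit_eq_one, one_smul] at h2
  exact h2.symm.trans h1

/-- The character `χ_V : H → ℂ` of an `H`-module `V`. -/
noncomputable def moduleCharacter (H : Type*) [Ring H] [Algebra ℂ H] (V : Type*) [AddCommGroup V]
    [Module ℂ V] [Module H V] [IsScalarTower ℂ H V] : H →ₗ[ℂ] ℂ :=
  LinearMap.trace ℂ V ∘ₗ (Algebra.lsmul ℂ ℂ V : H →ₐ[ℂ] Module.End ℂ V).toLinearMap

/-- The `n`-th Frobenius-Schur indicator `χ_V(Λ^{[n]})` of an `H`-module `V`, where `Λ` is the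
normalized integral of `H`. -/
noncomputable def fsIndicator (Λ : H) (n : ℕ) (V : Type*) [AddCommGroup V]
    [Module ℂ V] [Module H V] [IsScalarTower ℂ H V] : ℂ :=
  moduleCharacter H V (sweedlerPow H n Λ)

end Hopf

/-! ### The Drinfel'd double of a finite group -/

/-- The underlying space of the Drinfel'd double `D(G) = ℂ^G ⊗ ℂG`, an element being given by
its coordinates in the basis `e_g ⊗ x` with `g, x ∈ G`. -/
def DrinfeldDouble (G : Type*) : Type _ := G × G → ℂ

namespace DrinfeldDouble

variable {G : Type*}

noncomputable instance : AddCommGroup (DrinfeldDouble G) :=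
  inferInstanceAs (AddCommGroup (G × G → ℂ))

noncomputable instance : Module ℂ (DrinfeldDouble G) :=
  inferInstanceAs (Module ℂ (G × G → ℂ))

theorem add_apply (f h : DrinfeldDouble G) (p : G × G) : (f + h) p = f p + h p := rfl

theorem smul_apply (c : ℂ) (f : DrinfeldDouble G) (p : G × G) : (c • f) p = c * f p := rfl

theorem zero_apply (p : G × G) : (0 : DrinfeldDouble G) p = 0 := rfl

@[ext] theorem ext {f h : DrinfeldDouble G} (H : ∀ p, f p = h p) : f = h := funext H

theorem sum_apply {ι : Type*} (s : Finset ι) (f : ι → DrinfeldDouble G) (p : G × G) :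
    (∑ i ∈ s, f i) p = ∑ i ∈ s, f i p :=
  Finset.sum_apply p s f

variable [Fintype G] [DecidableEq G]

/-- The basis of `D(G)` formed by the elements `e_g ⊗ x`. -/
noncomputable def basis (G : Type*) [Fintype G] [DecidableEq G] :
    Module.Basis (G × G) ℂ (DrinfeldDouble G) :=
  Pi.basisFun ℂ (G × G)

instance : FiniteDimensional ℂ (DrinfeldDouble G) := (basis G).finiteDimensional_of_finite

/-- The basis element `e_g ⊗ x`. -/
noncomputable abbrev e (g x : G) : DrinfeldDouble G := basis G (g, x)

theorem e_apply (g x : G) (p : G × G) : e g x p = if p.1 = g ∧ p.2 = x then 1 else 0 := by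
  have : e g x p = (Pi.single (g, x) 1 : G × G → ℂ) p := by
    rw [← Pi.basisFun_apply]; rfl
  rw [this, Pi.single_apply]
  simp [Prod.ext_iff]

variable [Group G]

/-- The product is determined by `(e_g ⊗ x)(e_h ⊗ y) = δ_{g, x h x⁻¹} e_g ⊗ xy`,
see `e_mul_e`. -/
noncomputable instance : Mul (DrinfeldDouble G) where
  mul f h := fun p => ∑ y : G, f (p.1, y) * h (y⁻¹ * p.1 * y, y⁻¹ * p.2)

/-- The unit is `∑_g e_g ⊗ 1`. -/
noncomputable instance : One (DrinfeldDouble G) where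
  one := fun p => if p.2 = 1 then 1 else 0

theorem mul_apply {K : Type*} [Group K] [Fintype K] (f h : DrinfeldDouble K) (p : K × K) :
    (f * h) p = ∑ y : K, f (p.1, y) * h (y⁻¹ * p.1 * y, y⁻¹ * p.2) := rfl

theorem one_apply {K : Type*} [Group K] [DecidableEq K] (p : K × K) :
    (1 : DrinfeldDouble K) p = if p.2 = 1 then 1 else 0 := rfl

theorem one_eq_sum : (1 : DrinfeldDouble G) = ∑ g : G, e g 1 := by
  ext ⟨a, b⟩
  rw [sum_apply, one_apply]
  by_cases hb : b = 1 <;> simp [e_apply, hb]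

theorem e_mul_e (g x h y : G) :
    e g x * e h y = if g = x * h * x⁻¹ then e g (x * y) else 0 := by
  ext ⟨a, b⟩
  rw [mul_apply, Finset.sum_eq_single x]
  · have h1 : x⁻¹ * a * x = h ↔ a = x * h * x⁻¹ := by
      constructor
      · rintro rfl; group
      · rintro rfl; group
    simp only [e_apply, h1, inv_mul_eq_iff_eq_mul]
    by_cases hg : g = x * h * x⁻¹
    · rw [if_pos hg, e_apply]
      subst hg
      by_cases ha : a = x * h * x⁻¹ <;> simp [ha]
    · rw [if_neg hg, zero_apply]
      by_cases ha : a = g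
      · subst ha; simp [hg]
      · simp [ha]
  · intro z _ hz
    simp [e_apply, hz]
  · simp

noncomputable instance : Ring (DrinfeldDouble G) :=
  { (inferInstance : AddCommGroup (DrinfeldDouble G)),
    (inferInstance : Mul (DrinfeldDouble G)),
    (inferInstance : One (DrinfeldDouble G)) with
    mul_assoc := by
      intro f h k
      ext ⟨g, x⟩
      simp only [mul_apply, Finset.sum_mul, Finset.mul_sum]
      rw [Finset.sum_comm]
      refine Finset.sum_congr rfl fun y _ => ?_
      refine Fintype.sum_equiv (Equiv.mulLeft y⁻¹) _ _ fun z => ?_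
      simp [mul_assoc]
    one_mul := by
      intro f
      ext ⟨g, x⟩
      simp [mul_apply, one_apply]
    mul_one := by
      intro f
      ext ⟨g, x⟩
      simp [mul_apply, one_apply, inv_mul_eq_one]
    left_distrib := by
      intro f h k
      ext p
      simp [mul_apply, add_apply, mul_add, Finset.sum_add_distrib]
    right_distrib := by
      intro f h k
      ext p
      simp [mul_apply, add_apply, add_mul, Finset.sum_add_distrib]
    zero_mul := by
      intro f
      ext p
      simp [mul_apply, zero_apply]
    mul_zero := by
      intro f
      ext p
      simp [mul_apply, zero_apply]
    zsmul := fun n f => n • f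
    zsmul_zero' := fun f => zero_zsmul f
    zsmul_succ' := fun n f => SubNegMonoid.zsmul_succ' n f
    zsmul_neg' := fun n f => SubNegMonoid.zsmul_neg' n f
    neg_add_cancel := fun f => neg_add_cancel f }

noncomputable instance : Algebra ℂ (DrinfeldDouble G) :=
  Algebra.ofModule
    (by
      intro c f h
      ext p
      simp [mul_apply, smul_apply, Finset.mul_sum, mul_assoc])
    (by
      intro c f h
      ext p
      simp only [mul_apply, smul_apply, Finset.mul_sum]
      exact Finset.sum_congr rfl fun y _ => by ring)

/-- The comultiplication `Δ(e_g ⊗ x) = ∑_{ab = g} (e_a ⊗ x) ⊗ (e_b ⊗ x)`. -/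
noncomputable def comulMap (G : Type*) [Group G] [Fintype G] [DecidableEq G] :
    DrinfeldDouble G →ₗ[ℂ] DrinfeldDouble G ⊗[ℂ] DrinfeldDouble G :=
  (basis G).constr ℂ fun p => ∑ a : G, e a p.2 ⊗ₜ[ℂ] e (a⁻¹ * p.1) p.2

/-- The counit `ε(e_g ⊗ x) = δ_{g, 1}`. -/
noncomputable def counitMap (G : Type*) [Group G] [Fintype G] [DecidableEq G] :
    DrinfeldDouble G →ₗ[ℂ] ℂ :=
  (basis G).constr ℂ fun p => if p.1 = 1 then 1 else 0

/-- The antipode `S(e_g ⊗ x) = e_{x⁻¹ g⁻¹ x} ⊗ x⁻¹`. -/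
noncomputable def antipodeMap (G : Type*) [Group G] [Fintype G] [DecidableEq G] :
    DrinfeldDouble G →ₗ[ℂ] DrinfeldDouble G :=
  (basis G).constr ℂ fun p => e (p.2⁻¹ * p.1⁻¹ * p.2) p.2⁻¹

theorem comulMap_e (g x : G) :
    comulMap G (e g x) = ∑ a : G, e a x ⊗ₜ[ℂ] e (a⁻¹ * g) x :=
  (basis G).constr_basis ℂ _ _

theorem counitMap_e (g x : G) : counitMap G (e g x) = if g = 1 then 1 else 0 :=
  (basis G).constr_basis ℂ _ _

theorem antipodeMap_e (g x : G) : antipodeMap G (e g x) = e (x⁻¹ * g⁻¹ * x) x⁻¹ :=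
  (basis G).constr_basis ℂ _ _

noncomputable instance : Coalgebra ℂ (DrinfeldDouble G) where
  comul := comulMap G
  counit := counitMap G
  coassoc := by
    refine (basis G).ext fun ⟨g, x⟩ => ?_
    simp only [LinearMap.comp_apply, comulMap_e, map_sum, LinearMap.rTensor_tmul,
      LinearMap.lTensor_tmul, TensorProduct.sum_tmul, TensorProduct.tmul_sum,
      LinearEquiv.coe_coe, TensorProduct.assoc_tmul]
    rw [Finset.sum_comm]
    refine Finset.sum_congr rfl fun a _ => ?_
    refine Fintype.sum_equiv (Equiv.mulLeft a⁻¹) _ _ fun b => ?_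
    simp [mul_assoc]
  rTensor_counit_comp_comul := by
    refine (basis G).ext fun ⟨g, x⟩ => ?_
    simp only [LinearMap.comp_apply, comulMap_e, map_sum, LinearMap.rTensor_tmul, counitMap_e]
    rw [Finset.sum_eq_single 1] <;> simp +contextual
  lTensor_counit_comp_comul := by
    refine (basis G).ext fun ⟨g, x⟩ => ?_
    simp only [LinearMap.comp_apply, comulMap_e, map_sum, LinearMap.lTensor_tmul, counitMap_e]
    rw [Finset.sum_eq_single g]
    · simp
    · intro a _ ha
      simp [inv_mul_eq_one, ha]
    · simp

theorem comul_e (g x : G) :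
    Coalgebra.comul (R := ℂ) (e g x) = ∑ a : G, e a x ⊗ₜ[ℂ] e (a⁻¹ * g) x :=
  comulMap_e g x

theorem counit_e (g x : G) : Coalgebra.counit (R := ℂ) (e g x) = if g = 1 then 1 else 0 :=
  counitMap_e g x

noncomputable instance : Bialgebra ℂ (DrinfeldDouble G) where
  counit_one := by simp [one_eq_sum, counit_e]
  mul_compr₂_counit := by
    refine LinearMap.ext_basis (basis G) (basis G) fun ⟨g, x⟩ ⟨h, y⟩ => ?_
    simp only [LinearMap.compr₂_apply, LinearMap.compl₁₂_apply, LinearMap.mul_apply', e_mul_e,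
      counit_e]
    by_cases hg : g = 1
    · subst hg
      have : (1 = x * h * x⁻¹) ↔ h = 1 := by rw [eq_comm, conj_eq_one_iff]
      by_cases hh : h = 1 <;> simp [this, hh, counit_e]
    · rw [if_neg hg, zero_mul]
      by_cases hh : g = x * h * x⁻¹
      · rw [if_pos hh, counit_e, if_neg hg]
      · rw [if_neg hh, map_zero]
  comul_one := by
    rw [one_eq_sum, map_sum, Algebra.TensorProduct.one_def, one_eq_sum, TensorProduct.sum_tmul]
    simp only [comul_e, TensorProduct.tmul_sum]
    rw [Finset.sum_comm]
    refine Finset.sum_congr rfl fun a _ => ?_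
    exact Fintype.sum_equiv (Equiv.mulLeft a⁻¹) _ _ fun b => by simp
  mul_compr₂_comul := by
    refine LinearMap.ext_basis (basis G) (basis G) fun ⟨g, x⟩ ⟨h, y⟩ => ?_
    simp only [LinearMap.compr₂_apply, LinearMap.compl₁₂_apply, LinearMap.mul_apply', e_mul_e,
      comul_e, Finset.sum_mul_sum, Algebra.TensorProduct.tmul_mul_tmul]
    have key : ∀ a : G, (∑ b : G,
        (if a = x * b * x⁻¹ then e a (x * y) else 0) ⊗ₜ[ℂ]
          (if a⁻¹ * g = x * (b⁻¹ * h) * x⁻¹ then e (a⁻¹ * g) (x * y) else 0)) =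
        if g = x * h * x⁻¹ then e a (x * y) ⊗ₜ[ℂ] e (a⁻¹ * g) (x * y) else 0 := by
      intro a
      rw [Finset.sum_eq_single (x⁻¹ * a * x)]
      · have h1 : a = x * (x⁻¹ * a * x) * x⁻¹ := by group
        have h2 : x * ((x⁻¹ * a * x)⁻¹ * h) * x⁻¹ = a⁻¹ * (x * h * x⁻¹) := by group
        rw [if_pos h1, h2]
        by_cases hg : g = x * h * x⁻¹ <;> simp [hg]
      · intro b _ hb
        rw [if_neg, TensorProduct.zero_tmul]
        rintro rfl
        apply hb
        group
      · simp
    simp only [key]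
    by_cases hg : g = x * h * x⁻¹
    · simp only [if_pos hg, comul_e]
    · simp [if_neg hg]

noncomputable instance : HopfAlgebra ℂ (DrinfeldDouble G) where
  antipode := antipodeMap G
  mul_antipode_rTensor_comul := by
    refine (basis G).ext fun ⟨g, x⟩ => ?_
    simp only [LinearMap.comp_apply, comul_e, map_sum, LinearMap.rTensor_tmul, antipodeMap_e,
      LinearMap.mul'_apply, e_mul_e, counit_e, Algebra.linearMap_apply]
    have h1 : ∀ a : G, x⁻¹ * a⁻¹ * x = x⁻¹ * (a⁻¹ * g) * x⁻¹⁻¹ ↔ g = 1 := by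
      intro a
      simp [mul_assoc]
    simp only [h1]
    by_cases hg : g = 1
    · simp only [hg, if_true, map_one, one_eq_sum, inv_mul_cancel]
      refine Fintype.sum_equiv ((Equiv.inv G).trans (MulAut.conj x⁻¹).toEquiv) _ _ fun a => ?_
      simp [mul_assoc]
    · simp [hg]
  mul_antipode_lTensor_comul := by
    refine (basis G).ext fun ⟨g, x⟩ => ?_
    simp only [LinearMap.comp_apply, comul_e, map_sum, LinearMap.lTensor_tmul, antipodeMap_e,
      LinearMap.mul'_apply, e_mul_e, counit_e, Algebra.linearMap_apply]
    have h1 : ∀ a : G, a = x * (x⁻¹ * (a⁻¹ * g)⁻¹ * x) * x⁻¹ ↔ g = 1 := by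
      intro a
      simp [mul_assoc]
    simp only [h1]
    by_cases hg : g = 1
    · simp [hg, one_eq_sum]
    · simp [hg]

/-- The normalized integral `Λ = |G|⁻¹ ∑_x e_1 ⊗ x` of `D(G)`. -/
noncomputable def integral (G : Type*) [Group G] [Fintype G] [DecidableEq G] : DrinfeldDouble G :=
  (Fintype.card G : ℂ)⁻¹ • ∑ x : G, e 1 x

theorem isNormalizedIntegral_integral : IsNormalizedIntegral (integral G) where
  mul_left := by
    intro k
    have : LinearMap.mulRight ℂ (integral G) =
        (Coalgebra.counit (R := ℂ) (A := DrinfeldDouble G)).smulRight (integral G) := by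
      refine (basis G).ext fun ⟨g, x⟩ => ?_
      simp only [LinearMap.mulRight_apply, LinearMap.smulRight_apply, counit_e, integral,
        mul_smul_comm, Finset.mul_sum, e_mul_e]
      by_cases hg : g = 1
      · subst hg
        simp only [mul_one, mul_inv_cancel, if_true, one_smul]
        congr 1
        exact Fintype.sum_equiv (Equiv.mulLeft x) _ _ fun b => by simp
      · simp [hg]
    exact LinearMap.congr_fun this k
  mul_right := by
    intro k
    have : LinearMap.mulLeft ℂ (integral G) =
        (Coalgebra.counit (R := ℂ) (A := DrinfeldDouble G)).smulRight (integral G) := by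
      refine (basis G).ext fun ⟨g, x⟩ => ?_
      simp only [LinearMap.mulLeft_apply, LinearMap.smulRight_apply, counit_e, integral,
        smul_mul_assoc, Finset.sum_mul, e_mul_e]
      have h1 : ∀ b : G, 1 = b * g * b⁻¹ ↔ g = 1 := fun b => by
        rw [eq_comm, conj_eq_one_iff]
      simp only [h1]
      by_cases hg : g = 1
      · simp only [hg, if_true, one_smul]
        congr 1
        exact Fintype.sum_equiv (Equiv.mulRight x) _ _ fun b => by simp
      · simp [hg]
    exact LinearMap.congr_fun this k
  counit_eq_one := by
    simp [integral, counit_e]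

/-- An irreducible `D(G)`-module is finite-dimensional. -/
theorem finiteDimensional_of_isSimpleModule (V : Type*) [AddCommGroup V] [Module ℂ V]
    [Module (DrinfeldDouble G) V] [IsScalarTower ℂ (DrinfeldDouble G) V]
    [IsSimpleModule (DrinfeldDouble G) V] : FiniteDimensional ℂ V :=
  Module.Finite.trans (DrinfeldDouble G) V

end DrinfeldDouble

/-! ### `FSZ`-groups -/

/-- `G` is an `FSZ_n`-group: the `n`-th indicator of every irreducible representation `V` of
`D(G)` is an integer. Every irreducible representation is a quotient of `D(G)`, so those in the
universe of `G` are all of them up to isomorphism. -/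
def IsFSZn.{u} (G : Type u) [Group G] [Fintype G] [DecidableEq G] (n : ℕ) : Prop :=
  ∀ (V : Type u) [AddCommGroup V] [Module ℂ V] [Module (DrinfeldDouble G) V]
    [IsScalarTower ℂ (DrinfeldDouble G) V] [IsSimpleModule (DrinfeldDouble G) V],
    ∃ k : ℤ, fsIndicator (DrinfeldDouble.integral G) n V = (k : ℂ)

/-- `G` is an `FSZ`-group: it is `FSZ_n` for all positive integers `n`. -/
def IsFSZ (G : Type*) [Group G] [Fintype G] [DecidableEq G] : Prop :=
  ∀ n : ℕ, 0 < n → IsFSZn G n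

/-!
Let `R_n(a, g)` be the set of all `y` with `y ^ n = (a * y) ^ n = g`. Expanding `Λ^[n]` shows that
`ν_n(V)` is the sum over `a` and `g` of `|R_n(a, g)| χ_V(e_a ⊗ g⁻¹)`. For commuting `a` and `g`, the
element `e_a ⊗ g⁻¹` acts on `V` as an operator `A` with `A ^ (e + 1) = A`, where `e` is the order of
`G`, and the sum of the traces of `A ^ m` over the `m` coprime to `e` is rational. So `ν_n(V)` is
rational as soon as `|R_n(a, g)| ≤ |R_n(a, g ^ m)|` for every `m` coprime to `e`. It is also an
algebraic integer, being the trace on the `n`-th tensor power of `V` of the product of a cyclic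
rotation and a commuting idempotent.

For permutations, an element `y` of `R_n(a, g)` is turned into one of `R_n(a, g ^ m)` by multiplying
it by a permutation that acts on each cycle `c` of `g` as a power `g ^ β c`. This requires that
`1 + β c + β (y c) + ⋯ + β (y ^ (n - 1) c) ≡ m` modulo the length of `c`, and likewise for `a * y`.
On the cycles of a given length, write `n = u * d` with `u` the largest divisor of `n` coprime to
that length. Then all cycles of the permutations that `y ^ u` and `(a * y) ^ u` induce have length
`d`, so by Hall's theorem they have a common transversal, and a suitable multiple of its indicator
function is a solution `β`. The values of `β` can be taken even, so that the multiplier is a square,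
which lies in the alternating group.
-/

section TensorPowers

variable {ι R : Type*} [CommSemiring R] {n : ℕ}

/-- The matrix of the tensor product `A₀ ⊗ ⋯ ⊗ Aₙ₋₁` of the linear maps with matrices `A k`, in the
basis of pure tensors, which is indexed by `Fin n → ι`. -/
def tensorMatrix (A : Fin n → Matrix ι ι R) : Matrix (Fin n → ι) (Fin n → ι) R :=
  Matrix.of fun I J => ∏ k, A k (I k) (J k)

theorem tensorMatrix_mul [Fintype ι] (A B : Fin n → Matrix ι ι R) :
    tensorMatrix A * tensorMatrix B = tensorMatrix fun k => A k * B k := by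
  ext I J
  simp only [tensorMatrix, Matrix.mul_apply, Matrix.of_apply, ← Finset.prod_mul_distrib,
    Finset.prod_univ_sum, Fintype.piFinset_univ]

theorem tensorMatrix_eq_zero {A : Fin n → Matrix ι ι R} {k : Fin n} (hk : A k = 0) :
    tensorMatrix A = 0 := by
  ext I J
  exact Finset.prod_eq_zero (Finset.mem_univ k) (by rw [hk, Matrix.zero_apply])

/-- The cyclic rotation of the index set `Fin n → ι` of the basis of pure tensors; its permutation
matrix rotates the tensor factors. -/
def rotateIndex (n : ℕ) (ι : Type*) : Equiv.Perm (Fin n → ι) :=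
  (finRotate n).arrowCongr (Equiv.refl ι)

theorem rotateIndex_apply (I : Fin n → ι) (k : Fin n) :
    rotateIndex n ι I k = I ((finRotate n).symm k) := rfl

theorem rotateIndex_snoc (I : Fin n → ι) (i : ι) :
    rotateIndex (n + 1) ι (Fin.snoc I i) = Fin.cons i I := by
  ext k
  simp only [rotateIndex_apply, Fin.snoc_eq_cons_rotate, Equiv.apply_symm_apply]

theorem rotateIndex_pow (n j : ℕ) (ι : Type*) :
    rotateIndex n ι ^ j = (finRotate n ^ j).arrowCongr (Equiv.refl ι) := by
  induction j with
  | zero => rfl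
  | succ j ih => rw [pow_succ, pow_succ, ih]; rfl

theorem finRotate_pow_self (n : ℕ) : finRotate n ^ n = 1 := by
  match n with
  | 0 | 1 => exact Subsingleton.elim _ _
  | n + 2 =>
    have h : orderOf (finRotate (n + 2)) = n + 2 := by
      rw [isCycle_finRotate.orderOf, support_finRotate, Finset.card_univ, Fintype.card_fin]
    exact orderOf_dvd_iff_pow_eq_one.1 h.dvd

theorem rotateIndex_pow_self (n : ℕ) (ι : Type*) : rotateIndex n ι ^ n = 1 := by
  rw [rotateIndex_pow, finRotate_pow_self]
  rfl

theorem tensorMatrix_submatrix_rotateIndex (A : Fin n → Matrix ι ι R) :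
    (tensorMatrix A).submatrix (rotateIndex n ι) (rotateIndex n ι) =
      tensorMatrix fun k => A (finRotate n k) := by
  ext I J
  simp only [tensorMatrix, Matrix.submatrix_apply, Matrix.of_apply, rotateIndex_apply]
  rw [← Equiv.prod_comp (finRotate n)]
  simp only [Equiv.symm_apply_apply]

variable [Fintype ι] [DecidableEq ι]

theorem permMatrix_pow {κ : Type*} [Fintype κ] [DecidableEq κ] (σ : Equiv.Perm κ) (n : ℕ) :
    σ.permMatrix R ^ n = (σ ^ n).permMatrix R := by
  induction n with
  | zero => simp
  | succ n ih => rw [pow_succ, ih, ← Matrix.permMatrix_mul, ← pow_succ']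

theorem commute_permMatrix_iff {κ : Type*} [Fintype κ] [DecidableEq κ] {σ : Equiv.Perm κ}
    {M : Matrix κ κ R} : Commute (σ.permMatrix R) M ↔ M.submatrix σ σ = M := by
  rw [commute_iff_eq, Equiv.Perm.permMatrix, PEquiv.toMatrix_toPEquiv_mul,
    PEquiv.mul_toMatrix_toPEquiv]
  constructor <;> intro h
  · ext i j
    simpa using congr_fun₂ h i (σ j)
  · ext i j
    simpa using congr_fun₂ h i (σ.symm j)

theorem prod_ofFn_apply_eq_sum_paths (A : Fin (n + 1) → Matrix ι ι R) (i j : ι) :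
    (List.ofFn A).prod i j = ∑ I : Fin n → ι,
      ∏ k, A k ((Fin.cons i I : Fin (n + 1) → ι) k) ((Fin.snoc I j : Fin (n + 1) → ι) k) := by
  induction n generalizing i with
  | zero => simp [Fin.snoc]
  | succ n ih =>
    rw [List.ofFn_succ, List.prod_cons, Matrix.mul_apply, ← (Fin.consEquiv fun _ => ι).sum_comp,
      Fintype.sum_prod_type]
    refine Finset.sum_congr rfl fun l _ => ?_
    rw [ih, Finset.mul_sum]
    refine Finset.sum_congr rfl fun I _ => ?_
    change _ = ∏ k, A k ((Fin.cons i (Fin.cons l I) : Fin (n + 2) → ι) k)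
      ((Fin.snoc (Fin.cons l I : Fin (n + 1) → ι) j : Fin (n + 2) → ι) k)
    rw [← Fin.cons_snoc_eq_snoc_cons, Fin.prod_univ_succ (n := n + 1)]
    rfl

theorem trace_permMatrix_rotateIndex_mul_tensorMatrix (hn : n ≠ 0) (A : Fin n → Matrix ι ι R) :
    ((rotateIndex n ι).permMatrix R * tensorMatrix A).trace = (List.ofFn A).prod.trace := by
  obtain ⟨n, rfl⟩ := Nat.exists_eq_succ_of_ne_zero hn
  rw [Equiv.Perm.permMatrix, PEquiv.toMatrix_toPEquiv_mul, Matrix.trace, Matrix.trace,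
    ← (Fin.snocEquiv fun _ => ι).sum_comp, Fintype.sum_prod_type]
  simp only [Matrix.diag_apply, prod_ofFn_apply_eq_sum_paths]
  refine Finset.sum_congr rfl fun i _ => Finset.sum_congr rfl fun I _ => ?_
  rw [Matrix.submatrix_apply, ← rotateIndex_snoc]
  rfl

theorem isIntegral_trace {R K : Type*} [CommRing R] [Field K] [IsAlgClosed K] [Algebra R K]
    {A : Matrix ι ι K} (hA : IsIntegral R A) : IsIntegral R A.trace := by
  obtain ⟨p, hp, hpA⟩ := hA
  rw [Matrix.trace_eq_sum_roots_charpoly]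
  refine IsIntegral.multiset_sum fun r hr => ⟨p, hp, ?_⟩
  have hr : r ∈ spectrum K A :=
    Matrix.mem_spectrum_iff_isRoot_charpoly.2 (Polynomial.isRoot_of_mem_roots hr)
  have h := spectrum.subset_polynomial_aeval A (p.map (algebraMap R K)) ⟨r, hr, rfl⟩
  rw [Polynomial.aeval_map_algebraMap, Polynomial.aeval_def, hpA] at h
  have : Nontrivial (Matrix ι ι K) := by
    by_contra hs
    rw [not_nontrivial_iff_subsingleton] at hs
    simp only [spectrum.of_subsingleton, Set.mem_empty_iff_false] at hr
  simpa [Polynomial.eval_map] using h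

end TensorPowers

section TracesOfPowers

theorem mul_sum_pow_of_pow_succ_eq_self {R : Type*} [Semiring R] {A : R} {e : ℕ}
    (hA : A ^ (e + 1) = A) : A * ∑ j ∈ Finset.Icc 1 e, A ^ j = ∑ j ∈ Finset.Icc 1 e, A ^ j := by
  have shift : ∑ j ∈ Finset.Icc 1 e, A ^ j = ∑ j ∈ Finset.range e, A ^ (j + 1) := by
    rw [Finset.range_eq_Ico, Finset.sum_Ico_add' (fun j => A ^ j) 0 e 1]
    rfl
  rcases e with _ | e
  · simp
  · rw [shift, Finset.mul_sum]
    simp only [← pow_succ']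
    rw [Finset.sum_range_succ, hA, Finset.sum_range_succ' _ e, zero_add, pow_one]

theorem isIdempotentElem_inv_smul_sum_pow {K R : Type*} [Field K] [CharZero K] [Ring R]
    [Algebra K R] {A : R} {e : ℕ} (he : e ≠ 0) (hA : A ^ (e + 1) = A) :
    IsIdempotentElem ((e : K)⁻¹ • ∑ j ∈ Finset.Icc 1 e, A ^ j) := by
  have pow_mul_sum (j : ℕ) : A ^ j * ∑ i ∈ Finset.Icc 1 e, A ^ i = ∑ i ∈ Finset.Icc 1 e, A ^ i := by
    induction j with
    | zero => rw [pow_zero, one_mul]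
    | succ j ih => rw [pow_succ, mul_assoc, mul_sum_pow_of_pow_succ_eq_self hA, ih]
  rw [IsIdempotentElem, smul_mul_smul_comm, Finset.sum_mul]
  simp only [pow_mul_sum]
  rw [Finset.sum_const, Nat.card_Icc, add_tsub_cancel_right, ← Nat.cast_smul_eq_nsmul K,
    smul_smul, mul_assoc, inv_mul_cancel₀ (Nat.cast_ne_zero.2 he), mul_one]

theorem sum_Icc_filter_dvd {M : Type*} [AddCommMonoid M] {d c : ℕ} (hd : 0 < d) (f : ℕ → M) :
    ∑ m ∈ Finset.Icc 1 (d * c) with d ∣ m, f m = ∑ j ∈ Finset.Icc 1 c, f (d * j) := by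
  symm
  refine Finset.sum_nbij (d * ·) ?_ ?_ ?_ fun _ _ => rfl
  · intro j hj
    rw [Finset.mem_Icc] at hj
    rw [Finset.mem_filter, Finset.mem_Icc]
    exact ⟨⟨Nat.mul_pos hd hj.1, Nat.mul_le_mul_left d hj.2⟩, dvd_mul_right d j⟩
  · exact (mul_right_injective₀ hd.ne').injOn
  · intro m hm
    rw [Finset.mem_coe, Finset.mem_filter, Finset.mem_Icc] at hm
    obtain ⟨⟨hm1, hm2⟩, j, rfl⟩ := hm
    exact ⟨j, Finset.mem_Icc.2 ⟨Nat.pos_of_mul_pos_left hm1, Nat.le_of_mul_le_mul_left hm2 hd⟩, rfl⟩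

open ArithmeticFunction in
theorem sum_moebius_divisors_filter_dvd {e : ℕ} (he : e ≠ 0) (m : ℕ) :
    ∑ d ∈ e.divisors with d ∣ m, moebius d = if m.Coprime e then 1 else 0 := by
  have h := congrArg (· (m.gcd e)) moebius_mul_coe_zeta
  simp only [coe_mul_zeta_apply, one_apply] at h
  simp only [Nat.coprime_iff_gcd_eq_one, ← h]
  refine Finset.sum_congr ?_ fun _ _ => rfl
  ext d
  simp [he, Nat.dvd_gcd_iff, and_comm]

theorem sum_filter_coprime_eq_sum_moebius {R : Type*} [Ring R] {e : ℕ} (he : e ≠ 0) (s : Finset ℕ)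
    (f : ℕ → R) :
    ∑ m ∈ s with m.Coprime e, f m =
      ∑ d ∈ e.divisors, (ArithmeticFunction.moebius d : R) * ∑ m ∈ s with d ∣ m, f m := by
  simp only [Finset.mul_sum, Finset.sum_filter]
  rw [Finset.sum_comm]
  refine Finset.sum_congr rfl fun m _ => ?_
  simp only [mul_ite, mul_zero]
  rw [← Finset.sum_filter, ← Finset.sum_mul, ← Int.cast_sum, sum_moebius_divisors_filter_dvd he]
  split_ifs <;> simp

variable {K V : Type*} [Field K] [AddCommGroup V] [Module K V] [FiniteDimensional K V]
  {A : Module.End K V} {e : ℕ}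

theorem trace_mem_bot_of_isIdempotentElem (hA : IsIdempotentElem A) :
    LinearMap.trace K V A ∈ (⊥ : Subring K) := by
  rw [((LinearMap.isProj_range_iff_isIdempotentElem A).2 hA).trace]
  exact natCast_mem _ _

variable [CharZero K]

theorem sum_trace_pow_mem_bot (he : e ≠ 0) (hA : A ^ (e + 1) = A) :
    ∑ j ∈ Finset.Icc 1 e, LinearMap.trace K V (A ^ j) ∈ (⊥ : Subring K) := by
  have h := mul_mem (natCast_mem (⊥ : Subring K) e)
    (trace_mem_bot_of_isIdempotentElem (isIdempotentElem_inv_smul_sum_pow (K := K) he hA))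
  rwa [map_smul, smul_eq_mul, mul_inv_cancel_left₀ (Nat.cast_ne_zero.2 he), map_sum] at h

theorem sum_coprime_trace_pow_mem_bot (he : e ≠ 0) (hA : A ^ (e + 1) = A) :
    ∑ m ∈ Finset.Icc 1 e with m.Coprime e, LinearMap.trace K V (A ^ m) ∈ (⊥ : Subring K) := by
  rw [sum_filter_coprime_eq_sum_moebius he]
  refine sum_mem fun d hd => mul_mem (intCast_mem _ _) ?_
  obtain ⟨⟨c, rfl⟩, -⟩ := Nat.mem_divisors.1 hd
  obtain ⟨hd, hc⟩ := mul_ne_zero_iff.1 he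
  simp only [sum_Icc_filter_dvd (Nat.pos_of_ne_zero hd), pow_mul]
  refine sum_trace_pow_mem_bot hc ?_
  obtain ⟨k, rfl⟩ := Nat.exists_eq_succ_of_ne_zero hd
  calc (A ^ (k + 1)) ^ (c + 1) = A ^ ((k + 1) * c + 1) * A ^ k := by
        rw [← pow_mul, ← pow_add]
        congr 1
        ring
    _ = A ^ (k + 1) := by rw [hA, pow_succ']

end TracesOfPowers

namespace DrinfeldDouble

section SweedlerPowers

variable {G : Type*} [Group G] [Fintype G] [DecidableEq G]

theorem sweedlerPow_zero_e (g x : G) :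
    sweedlerPow (DrinfeldDouble G) 0 (e g x) = if g = 1 then 1 else 0 := by
  simp only [sweedlerPow, LinearMap.comp_apply, counit_e, Algebra.linearMap_apply]
  split_ifs <;> simp

theorem sweedlerPow_succ_e (n : ℕ) (g x : G) :
    sweedlerPow (DrinfeldDouble G) (n + 1) (e g x) =
      ∑ b : G, sweedlerPow (DrinfeldDouble G) n (e b x) * e (b⁻¹ * g) x := by
  simp only [sweedlerPow, LinearMap.comp_apply, comul_e, map_sum, LinearMap.rTensor_tmul,
    LinearMap.mul'_apply]

theorem sweedlerPow_e (n : ℕ) (g x : G) :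
    sweedlerPow (DrinfeldDouble G) n (e g x) =
      ∑ a : G, if (a * x⁻¹) ^ n * x ^ n = g then e a (x ^ n) else 0 := by
  induction n generalizing g with
  | zero =>
    simp only [sweedlerPow_zero_e, pow_zero, mul_one, one_eq_sum, eq_comm (a := g)]
    split_ifs <;> simp
  | succ n ih =>
    have target_iff (a : G) : a = x ^ n * (((a * x⁻¹) ^ n * x ^ n)⁻¹ * g) * (x ^ n)⁻¹ ↔
        (a * x⁻¹) ^ (n + 1) * x ^ (n + 1) = g := by
      rw [eq_mul_inv_iff_mul_eq, mul_inv_rev, mul_assoc, mul_inv_cancel_left,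
        eq_inv_mul_iff_mul_eq, pow_succ (a * x⁻¹), pow_succ' x, mul_assoc, mul_assoc,
        inv_mul_cancel_left]
    simp only [sweedlerPow_succ_e, ih, Finset.sum_mul, ite_mul, zero_mul]
    rw [Finset.sum_comm]
    simp only [Finset.sum_ite_eq, Finset.mem_univ, if_true, e_mul_e, target_iff, ← pow_succ]

theorem sweedlerPow_e_eq_sum_tuples (n : ℕ) (g x : G) :
    sweedlerPow (DrinfeldDouble G) n (e g x) =
      ∑ a : Fin n → G with (List.ofFn a).prod = g, (List.ofFn fun k => e (a k) x).prod := by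
  rw [Finset.sum_filter]
  induction n generalizing g with
  | zero => simp [sweedlerPow_zero_e, eq_comm]
  | succ n ih =>
    rw [sweedlerPow_succ_e, ← (Fin.snocEquiv fun _ => G).sum_comp, Fintype.sum_prod_type_right]
    simp only [ih, Finset.sum_mul, ite_mul, zero_mul]
    rw [Finset.sum_comm]
    simp only [Finset.sum_ite_eq, Finset.mem_univ, if_true, List.ofFn_succ', List.concat_eq_append,
      List.prod_append, List.prod_singleton, Fin.snocEquiv_apply, Fin.snoc_castSucc, Fin.snoc_last,
      ← eq_inv_mul_iff_mul_eq, Finset.sum_ite_eq']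

theorem e_pow_of_commute {a g : G} (h : Commute a g) {k : ℕ} (hk : 0 < k) :
    e a g ^ k = e a (g ^ k) := by
  induction k, hk using Nat.le_induction with
  | base => rw [Nat.succ_eq_add_one, zero_add, pow_one, pow_one]
  | succ k _ ih =>
    rw [pow_succ, ih, e_mul_e, ← pow_succ, if_pos]
    rw [(h.pow_right k).symm.eq, mul_inv_cancel_right]

end SweedlerPowers
end DrinfeldDouble

section CommonRoots

variable {G : Type*} [Group G]

/-- The set `G_n(a, g)` of the `n`-th roots `y` of `g` for which `a * y` is an `n`-th root of `g`
too. The indicators of `D(G)` are determined by the numbers of elements of these sets. -/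
def commonRoots (n : ℕ) (a g : G) : Set G := {y | y ^ n = g ∧ (a * y) ^ n = g}

theorem commute_of_mem_commonRoots {n : ℕ} {a g y : G} (hy : y ∈ commonRoots n a g) :
    Commute a g := by
  have hyg : Commute y g := hy.1 ▸ Commute.self_pow y n
  have hayg : Commute (a * y) g := hy.2 ▸ Commute.self_pow (a * y) n
  simpa using hayg.mul_left hyg.inv_left

variable [Fintype G]

theorem sum_mul_comp_pow {R : Type*} [NonUnitalNonAssocSemiring R] {m : ℕ}
    (hm : m.Coprime (Fintype.card G)) {c : G → R} (hc : ∀ g, c (g ^ m) = c g) (f : G → R) :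
    ∑ g, c g * f (g ^ m) = ∑ g, c g * f g := by
  have hm : (Nat.card G).Coprime m := Nat.card_eq_fintype_card (α := G) ▸ hm.symm
  rw [← (powCoprime hm).sum_comp fun g => c g * f g]
  simp only [powCoprime_apply, hc]

theorem apply_pow_eq_of_apply_le_apply_pow {m : ℕ} (hm : m.Coprime (Fintype.card G)) {c : G → ℕ}
    (hc : ∀ g, c g ≤ c (g ^ m)) (g : G) : c (g ^ m) = c g := by
  have hm : (Nat.card G).Coprime m := Nat.card_eq_fintype_card (α := G) ▸ hm.symm
  have hsum : ∑ g, c g = ∑ g, c (g ^ m) := ((powCoprime hm).sum_comp c).symm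
  exact ((Finset.sum_eq_sum_iff_of_le fun g _ => hc g).1 hsum g (Finset.mem_univ g)).symm

end CommonRoots

namespace DrinfeldDouble

section Rationality

variable {G : Type*} [Group G] [Fintype G] [DecidableEq G]

theorem sweedlerPow_integral (n : ℕ) :
    sweedlerPow (DrinfeldDouble G) n (integral G) = (Fintype.card G : ℂ)⁻¹ •
      ∑ a : G, ∑ g : G, (commonRoots n a g).ncard • e a g⁻¹ := by
  classical
  have count (a g : G) : (commonRoots n a g).ncard • e a g⁻¹ =
      ∑ y : G, if y ^ n = g then if (a * y) ^ n = g then e a g⁻¹ else 0 else 0 := by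
    simp only [← ite_and]
    rw [← Finset.sum_filter, Finset.sum_const, Set.ncard_eq_toFinset_card', commonRoots,
      Set.toFinset_ofPred]
  rw [integral, map_smul, map_sum]
  simp only [sweedlerPow_e, count]
  rw [Finset.sum_comm]
  congr! 2 with a
  rw [Finset.sum_comm, ← Equiv.sum_comp (Equiv.inv G)]
  simp only [Equiv.inv_apply, inv_inv, inv_pow, mul_inv_eq_one, Finset.sum_ite_eq,
    Finset.mem_univ, if_true]

variable (V : Type*) [AddCommGroup V] [Module ℂ V] [Module (DrinfeldDouble G) V]
  [IsScalarTower ℂ (DrinfeldDouble G) V]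

theorem fsIndicator_integral_eq_sum (n : ℕ) :
    fsIndicator (integral G) n V = (Fintype.card G : ℂ)⁻¹ * ∑ a : G, ∑ g : G,
      (commonRoots n a g).ncard * moduleCharacter (DrinfeldDouble G) V (e a g⁻¹) := by
  simp only [fsIndicator, sweedlerPow_integral, map_smul, map_sum, map_nsmul, smul_eq_mul]
  simp only [nsmul_eq_mul]

variable [FiniteDimensional ℂ V]

theorem sum_coprime_moduleCharacter_e_mem_bot {a g : G} (h : Commute a g) :
    ∑ m ∈ Finset.Icc 1 (Fintype.card G) with m.Coprime (Fintype.card G),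
      moduleCharacter (DrinfeldDouble G) V (e a (g ^ m)) ∈ (⊥ : Subring ℂ) := by
  set A : Module.End ℂ V := Algebra.lsmul ℂ ℂ V (e a g) with hA
  have hpow {m : ℕ} (hm : 0 < m) : A ^ m = Algebra.lsmul ℂ ℂ V (e a (g ^ m)) := by
    rw [hA, ← map_pow, e_pow_of_commute h hm]
  have hcard : A ^ (Fintype.card G + 1) = A := by
    rw [hpow (Nat.succ_pos _), pow_succ, pow_card_eq_one, one_mul]
  convert sum_coprime_trace_pow_mem_bot Fintype.card_ne_zero hcard using 2 with m hm
  rw [Finset.mem_filter, Finset.mem_Icc] at hm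
  rw [hpow hm.1.1]
  rfl

theorem sum_commonRoots_mul_moduleCharacter_mem_fieldRange (n : ℕ) (a : G)
    (hG : ∀ (g : G) (m : ℕ), m.Coprime (Fintype.card G) →
      (commonRoots n a (g ^ m)).ncard = (commonRoots n a g).ncard) :
    ∑ g : G, (commonRoots n a g).ncard * moduleCharacter (DrinfeldDouble G) V (e a g⁻¹) ∈
      (algebraMap ℚ ℂ).fieldRange := by
  set χ := moduleCharacter (DrinfeldDouble G) V
  set U := {m ∈ Finset.Icc 1 (Fintype.card G) | m.Coprime (Fintype.card G)} with hU
  have hU0 : (U.card : ℂ) ≠ 0 := Nat.cast_ne_zero.2 <| Finset.card_ne_zero_of_mem (a := 1) <| by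
    simp [hU, Nat.one_le_iff_ne_zero]
  have average : U.card * ∑ g : G, (commonRoots n a g).ncard * χ (e a g⁻¹) =
      ∑ g : G, (commonRoots n a g).ncard * ∑ m ∈ U, χ (e a (g⁻¹ ^ m)) := by
    simp only [Finset.mul_sum (s := U)]
    rw [Finset.sum_comm, ← nsmul_eq_mul, ← Finset.sum_const]
    refine Finset.sum_congr rfl fun m hm => ?_
    simp only [inv_pow]
    exact (sum_mul_comp_pow (Finset.mem_filter.1 hm).2
      (fun g => congrArg Nat.cast (hG g m (Finset.mem_filter.1 hm).2)) fun g => χ (e a g⁻¹)).symm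
  rw [← inv_mul_cancel_left₀ hU0 (∑ g : G, _), average]
  refine mul_mem (inv_mem (natCast_mem _ _)) (sum_mem fun g _ => ?_)
  rcases (commonRoots n a g).eq_empty_or_nonempty with hempty | ⟨y, hy⟩
  · rw [hempty, Set.ncard_empty, Nat.cast_zero, zero_mul]
    exact zero_mem _
  · refine mul_mem (natCast_mem _ _) ?_
    exact (bot_le : ⊥ ≤ (algebraMap ℚ ℂ).fieldRange.toSubring)
      (sum_coprime_moduleCharacter_e_mem_bot V (commute_of_mem_commonRoots hy).inv_right)

theorem fsIndicator_mem_fieldRange {n : ℕ}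
    (hG : ∀ (a g : G) (m : ℕ), m.Coprime (Fintype.card G) →
      (commonRoots n a (g ^ m)).ncard = (commonRoots n a g).ncard) :
    fsIndicator (integral G) n V ∈ (algebraMap ℚ ℂ).fieldRange := by
  rw [fsIndicator_integral_eq_sum]
  exact mul_mem (inv_mem (natCast_mem _ _)) <| sum_mem fun a _ =>
    sum_commonRoots_mul_moduleCharacter_mem_fieldRange V n a (hG a)

end Rationality
end DrinfeldDouble

section Averages

theorem isIdempotentElem_inv_card_smul_sum {K R G : Type*} [Field K] [CharZero K] [Ring R]
    [Algebra K R] [Group G] [Fintype G] {f : G → R} (hf : ∀ x y, f x * f y = f (x * y)) :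
    IsIdempotentElem ((Fintype.card G : K)⁻¹ • ∑ x, f x) := by
  have absorb (x : G) : ∑ y, f x * f y = ∑ y, f y := by
    simp only [hf]
    exact Equiv.sum_comp (Equiv.mulLeft x) f
  rw [IsIdempotentElem, smul_mul_smul_comm, Finset.sum_mul_sum]
  simp only [absorb]
  rw [Finset.sum_const, Finset.card_univ, ← Nat.cast_smul_eq_nsmul K, smul_smul, mul_assoc,
    inv_mul_cancel₀ (Nat.cast_ne_zero.2 Fintype.card_ne_zero), mul_one]

theorem prod_ofFn_conj {G : Type*} [Group G] {n : ℕ} (a : Fin n → G) (x : G) :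
    (List.ofFn fun k => x * a k * x⁻¹).prod = x * (List.ofFn a).prod * x⁻¹ := by
  have h := map_list_prod (MulAut.conj x) (List.ofFn a)
  rw [List.map_ofFn] at h
  exact h.symm

theorem prod_ofFn_comp_finRotate_eq_one_iff {G : Type*} [Group G] {n : ℕ} (a : Fin n → G) :
    (List.ofFn fun k => a (finRotate n k)).prod = 1 ↔ (List.ofFn a).prod = 1 := by
  cases n with
  | zero => rfl
  | succ n =>
    rw [List.ofFn_succ', List.concat_eq_append, List.prod_append, List.prod_singleton,
      List.ofFn_succ, List.prod_cons, finRotate_last, mul_eq_one_comm]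
    simp only [finRotate_apply, Fin.coeSucc_eq_succ]

end Averages

namespace DrinfeldDouble

section Integrality

variable {G : Type*} [Group G] [Fintype G] [DecidableEq G] {ι : Type*} [Fintype ι] [DecidableEq ι]
  (ρ : DrinfeldDouble G →ₐ[ℂ] Matrix ι ι ℂ)

theorem tensorMatrix_e_mul {n : ℕ} (a b : Fin n → G) (x y : G) :
    (tensorMatrix fun k => ρ (e (a k) x)) * (tensorMatrix fun k => ρ (e (b k) y)) =
      if b = fun k => x⁻¹ * a k * x then tensorMatrix fun k => ρ (e (a k) (x * y)) else 0 := by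
  have eq_conj_iff (k : Fin n) : a k = x * b k * x⁻¹ ↔ b k = x⁻¹ * a k * x := by
    rw [eq_mul_inv_iff_mul_eq, mul_assoc, eq_inv_mul_iff_mul_eq, eq_comm]
  simp only [tensorMatrix_mul, ← map_mul, e_mul_e, eq_conj_iff]
  split_ifs with h
  · simp only [h, if_true]
  · obtain ⟨k, hk⟩ := Function.ne_iff.1 h
    refine tensorMatrix_eq_zero (k := k) ?_
    rw [if_neg hk, map_zero]

/-- The action of the `n`-fold coproduct `∑ (e_{a₀} ⊗ x) ⊗ ⋯ ⊗ (e_{aₙ₋₁} ⊗ x)` of `e_1 ⊗ x`, where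
`a₀ ⋯ aₙ₋₁ = 1`, on the `n`-th tensor power of the representation `ρ`. -/
noncomputable def tensorPowerAction (n : ℕ) (x : G) : Matrix (Fin n → ι) (Fin n → ι) ℂ :=
  ∑ a : Fin n → G with (List.ofFn a).prod = 1, tensorMatrix fun k => ρ (e (a k) x)

theorem tensorPowerAction_mul (n : ℕ) (x y : G) :
    tensorPowerAction ρ n x * tensorPowerAction ρ n y = tensorPowerAction ρ n (x * y) := by
  simp only [tensorPowerAction, Finset.sum_mul_sum, tensorMatrix_e_mul, Finset.sum_ite_eq']
  refine Finset.sum_congr rfl fun a ha => if_pos ?_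
  rw [Finset.mem_filter_univ] at ha ⊢
  have h := prod_ofFn_conj a x⁻¹
  rwa [ha, mul_one, mul_inv_cancel, inv_inv] at h

theorem commute_rotateIndex_tensorPowerAction (n : ℕ) (x : G) :
    Commute ((rotateIndex n ι).permMatrix ℂ) (tensorPowerAction ρ n x) := by
  have submatrix_sum : (tensorPowerAction ρ n x).submatrix (rotateIndex n ι) (rotateIndex n ι) =
      ∑ a : Fin n → G with (List.ofFn a).prod = 1,
        tensorMatrix fun k => ρ (e (a (finRotate n k)) x) := by
    ext I J
    simp only [tensorPowerAction, Matrix.submatrix_apply, Matrix.sum_apply]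
    refine Finset.sum_congr rfl fun a _ => ?_
    exact congr_fun₂ (tensorMatrix_submatrix_rotateIndex fun k => ρ (e (a k) x)) I J
  rw [commute_permMatrix_iff, submatrix_sum]
  refine Finset.sum_equiv (rotateIndex n G).symm (fun a => ?_) fun a _ => rfl
  rw [Finset.mem_filter_univ, Finset.mem_filter_univ, ← prod_ofFn_comp_finRotate_eq_one_iff]
  rfl

theorem trace_sweedlerPow_e_one {n : ℕ} (hn : n ≠ 0) (x : G) :
    (ρ (sweedlerPow (DrinfeldDouble G) n (e 1 x))).trace =
      ((rotateIndex n ι).permMatrix ℂ * tensorPowerAction ρ n x).trace := by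
  simp only [sweedlerPow_e_eq_sum_tuples, tensorPowerAction, map_sum, Finset.mul_sum,
    Matrix.trace_sum, trace_permMatrix_rotateIndex_mul_tensorMatrix hn, map_list_prod,
    List.map_ofFn, Function.comp_def]

theorem isIntegral_trace_sweedlerPow_integral {n : ℕ} (hn : n ≠ 0) :
    IsIntegral ℤ (ρ (sweedlerPow (DrinfeldDouble G) n (integral G))).trace := by
  set P := (rotateIndex n ι).permMatrix ℂ
  set Q := (Fintype.card G : ℂ)⁻¹ • ∑ x : G, tensorPowerAction ρ n x with hQ
  have trace_eq : (ρ (sweedlerPow (DrinfeldDouble G) n (integral G))).trace = (P * Q).trace := by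
    simp only [integral, hQ, map_smul, map_sum, mul_smul_comm, Matrix.trace_smul, Finset.mul_sum,
      Matrix.trace_sum, trace_sweedlerPow_e_one ρ hn, P]
  have commute : Commute P Q := (Commute.sum_right _ _ _ fun x _ =>
    commute_rotateIndex_tensorPowerAction ρ n x).smul_right _
  have idempotent : IsIdempotentElem Q :=
    isIdempotentElem_inv_card_smul_sum (tensorPowerAction_mul ρ n)
  have pow_eq_one : P ^ n = 1 := by
    rw [permMatrix_pow, rotateIndex_pow_self, Matrix.permMatrix_one]
  have pow_succ_eq_self : (P * Q) ^ (n + 1) = P * Q := by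
    rw [commute.mul_pow, idempotent.pow_succ_eq, pow_succ, pow_eq_one, one_mul]
  rw [trace_eq]
  refine isIntegral_trace ⟨Polynomial.X ^ (n + 1) - Polynomial.X, ?_, ?_⟩
  · refine Polynomial.monic_X_pow_sub ?_
    rw [Polynomial.degree_X]
    exact_mod_cast Nat.succ_lt_succ (Nat.pos_of_ne_zero hn)
  · simp [pow_succ_eq_self]

theorem isIntegral_fsIndicator_integral (V : Type*) [AddCommGroup V] [Module ℂ V]
    [Module (DrinfeldDouble G) V] [IsScalarTower ℂ (DrinfeldDouble G) V] [FiniteDimensional ℂ V]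
    {n : ℕ} (hn : n ≠ 0) : IsIntegral ℤ (fsIndicator (integral G) n V) := by
  let b := Module.finBasis ℂ V
  have h := isIntegral_trace_sweedlerPow_integral (G := G)
    ((LinearMap.toMatrixAlgEquiv b).toAlgHom.comp (Algebra.lsmul ℂ ℂ V)) hn
  rwa [fsIndicator, moduleCharacter, LinearMap.comp_apply, LinearMap.trace_eq_matrix_trace ℂ b]

theorem isFSZn_of_ncard_commonRoots_le {n : ℕ} (hn : n ≠ 0)
    (hG : ∀ (a g : G) (m : ℕ), m.Coprime (Fintype.card G) →
      (commonRoots n a g).ncard ≤ (commonRoots n a (g ^ m)).ncard) : IsFSZn G n := by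
  intro V _ _ _ _ _
  have : FiniteDimensional ℂ V := finiteDimensional_of_isSimpleModule (G := G) V
  obtain ⟨q, hq⟩ := fsIndicator_mem_fieldRange V fun a g m hm =>
    apply_pow_eq_of_apply_le_apply_pow hm (fun g => hG a g m hm) g
  have integral := isIntegral_fsIndicator_integral (G := G) V hn
  rw [← hq, isIntegral_algebraMap_iff (algebraMap ℚ ℂ).injective,
    IsIntegrallyClosed.isIntegral_iff] at integral
  obtain ⟨k, rfl⟩ := integral
  exact ⟨k, by rw [← hq, eq_intCast, map_intCast]⟩

end Integrality
end DrinfeldDouble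

section CommonTransversals

open Function Finset

variable {α P Q : Type*} [DecidableEq Q] {p : α → P} {q : α → Q}

theorem card_filter_map_of_bijective_comp [Fintype P] {w : P → α} (hw : LeftInverse p w)
    (hqw : Bijective (q ∘ w)) (b : Q) :
    #{x ∈ univ.map ⟨w, hw.injective⟩ | q x = b} = 1 := by
  obtain ⟨a, rfl, unique⟩ := hqw.existsUnique b
  refine card_eq_one.2 ⟨w a, ?_⟩
  ext x
  simp only [mem_filter, mem_map, mem_univ, true_and, Embedding.coeFn_mk,
    mem_singleton]
  constructor
  · rintro ⟨⟨a', rfl⟩, h⟩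
    rw [unique a' h]
  · rintro rfl
    exact ⟨⟨a, rfl⟩, rfl⟩

variable [Fintype α] [DecidableEq P] {c : ℕ}

theorem card_filter_mem_of_card_fiber_eq (hp : ∀ b, #{x | p x = b} = c) (s : Finset P) :
    #{x | p x ∈ s} = #s * c := by
  rw [card_eq_sum_card_fiberwise (f := p) (t := s) fun x hx => by simpa using hx]
  refine sum_const_nat fun b hb => ?_
  rw [filter_filter, ← hp b]
  congr! 2 with x
  exact and_iff_right_of_imp fun h => h ▸ hb

theorem exists_leftInverse_injective_comp (hc : c ≠ 0) (hp : ∀ b, #{x | p x = b} = c)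
    (hq : ∀ b, #{x | q x = b} = c) : ∃ w : P → α, LeftInverse p w ∧ Injective (q ∘ w) := by
  have hall (s : Finset P) : #s ≤ #(s.biUnion fun b => image q {x | p x = b}) := by
    refine Nat.le_of_mul_le_mul_right ?_ (Nat.pos_of_ne_zero hc)
    rw [← card_filter_mem_of_card_fiber_eq hp, ← card_filter_mem_of_card_fiber_eq hq]
    refine card_le_card fun x hx => ?_
    simp only [mem_filter, mem_univ, true_and, mem_biUnion,
      mem_image] at hx ⊢
    exact ⟨p x, hx, x, rfl, rfl⟩
  obtain ⟨f, injective, hf⟩ := (all_card_le_biUnion_card_iff_exists_injective _).1 hall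
  simp only [mem_image, mem_filter, mem_univ, true_and] at hf
  choose w hw hqw using hf
  exact ⟨w, hw, (funext hqw : q ∘ w = f) ▸ injective⟩

theorem card_eq_of_card_fiber_eq [Fintype P] [Fintype Q] (hc : c ≠ 0)
    (hp : ∀ b, #{x | p x = b} = c) (hq : ∀ b, #{x | q x = b} = c) :
    Fintype.card P = Fintype.card Q := by
  have hP := card_filter_mem_of_card_fiber_eq hp univ
  have hQ := card_filter_mem_of_card_fiber_eq hq univ
  simp only [mem_univ] at hP hQ
  exact Nat.eq_of_mul_eq_mul_right (Nat.pos_of_ne_zero hc) (hP.symm.trans hQ)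

theorem exists_common_transversal [Finite P] [Finite Q] (hc : c ≠ 0)
    (hp : ∀ b, #{x | p x = b} = c) (hq : ∀ b, #{x | q x = b} = c) :
    ∃ T : Finset α, (∀ b, #{x ∈ T | p x = b} = 1) ∧ ∀ b, #{x ∈ T | q x = b} = 1 := by
  have := Fintype.ofFinite P
  have := Fintype.ofFinite Q
  obtain ⟨w, hw, injective⟩ := exists_leftInverse_injective_comp hc hp hq
  refine ⟨univ.map ⟨w, hw.injective⟩, ?_, ?_⟩
  · exact card_filter_map_of_bijective_comp hw (hw.comp_eq_id ▸ bijective_id)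
  · exact card_filter_map_of_bijective_comp hw
      ((Fintype.bijective_iff_injective_and_card _).2
        ⟨injective, card_eq_of_card_fiber_eq hc hp hq⟩)

end CommonTransversals

section Arithmetic

theorem exists_mul_eq_coprime {n : ℕ} (hn : n ≠ 0) (i : ℕ) :
    ∃ c d, c * d = n ∧ c.Coprime i ∧ ∀ k, k ∣ d → k.Coprime i → k = 1 := by
  have nonempty : (n.divisors.filter fun c => c.Coprime i).Nonempty := ⟨1, by simp [hn]⟩
  obtain ⟨c, hc, maximal⟩ := Finset.exists_max_image _ id nonempty
  obtain ⟨hcn, coprime⟩ := Finset.mem_filter.1 hc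
  obtain ⟨d, rfl⟩ := Nat.dvd_of_mem_divisors hcn
  refine ⟨c, d, rfl, coprime, fun k hk hki => ?_⟩
  have c_pos : 0 < c := Nat.pos_of_ne_zero (left_ne_zero_of_mul hn)
  have le : c * k ≤ c * 1 := by
    rw [mul_one]
    exact maximal (c * k) (Finset.mem_filter.2
      ⟨Nat.mem_divisors.2 ⟨Nat.mul_dvd_mul_left c hk, hn⟩,
        Nat.coprime_mul_iff_left.2 ⟨coprime, hki⟩⟩)
  have k_pos : 0 < k := Nat.pos_of_dvd_of_pos hk (Nat.pos_of_ne_zero (right_ne_zero_of_mul hn))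
  exact le_antisymm (Nat.le_of_mul_le_mul_left le c_pos) k_pos

theorem exists_one_add_mul_two_mul_modEq {i c m : ℕ} (hc : c.Coprime i) (hm : m.Coprime i) :
    ∃ u : ℤ, 1 + c * (2 * u) ≡ m [ZMOD i] := by
  obtain ⟨r, hr⟩ := Int.mod_coprime hc
  obtain even | odd := i.even_or_odd
  · obtain ⟨k, rfl⟩ := Nat.coprime_two_right.1 (hm.coprime_dvd_right even.two_dvd)
    refine ⟨r * k, ?_⟩
    convert ((hr.mul_right (2 * k)).add_left 1) using 1 <;> push_cast <;> ring
  · obtain ⟨h, hh⟩ := Int.mod_coprime (Nat.coprime_two_left.2 odd)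
    refine ⟨r * h * (m - 1), ?_⟩
    convert (((hr.mul hh).mul_right (m - 1)).add_left 1) using 1 <;> push_cast <;> ring

theorem sum_range_mul_eq_sum_sum {M : Type*} [AddCommMonoid M] (f : ℕ → M) (c d : ℕ) :
    ∑ j ∈ Finset.range (c * d), f j =
      ∑ s ∈ Finset.range c, ∑ r ∈ Finset.range d, f (c * r + s) := by
  rw [Finset.sum_comm]
  induction d with
  | zero => simp
  | succ d ih => rw [mul_add_one, Finset.sum_range_add, ih, Finset.sum_range_succ]

end Arithmetic

section CycleTransversals

open Function Equiv
open scoped Finset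

variable {α : Type*}

theorem minimalPeriod_perm_pos [Finite α] (σ : Perm α) (x : α) : 0 < minimalPeriod σ x :=
  minimalPeriod_pos_of_mem_periodicPts (σ.injective.mem_periodicPts x)

theorem sum_range_minimalPeriod_perm [Fintype α] {M : Type*} [AddCommMonoid M] (σ : Perm α)
    [DecidableRel σ.SameCycle] (f : α → M) (x : α) :
    ∑ r ∈ Finset.range (minimalPeriod σ x), f ((σ ^ r) x) = ∑ y with σ.SameCycle x y, f y := by
  classical
  have injOn : Set.InjOn (fun r => (σ ^ r) x) (Finset.range (minimalPeriod σ x)) := by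
    simpa only [Finset.coe_range, ← Perm.iterate_eq_pow] using
      iterate_injOn_Iio_minimalPeriod (f := σ) (x := x)
  rw [← Finset.sum_image injOn]
  refine Finset.sum_congr ?_ fun _ _ => rfl
  ext y
  simp only [Finset.mem_image, Finset.mem_range, Finset.mem_filter, Finset.mem_univ, true_and]
  constructor
  · rintro ⟨r, -, rfl⟩
    exact ⟨r, by rw [zpow_natCast]⟩
  · intro h
    obtain ⟨r, rfl⟩ := h.exists_nat_pow_eq
    refine ⟨r % minimalPeriod σ x, Nat.mod_lt _ (minimalPeriod_perm_pos σ x), ?_⟩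
    simp only [← Perm.iterate_eq_pow, iterate_mod_minimalPeriod_eq]

theorem card_filter_sameCycle_eq_minimalPeriod [Fintype α] (σ : Perm α)
    [DecidableRel σ.SameCycle] (x : α) : #{y | σ.SameCycle x y} = minimalPeriod σ x := by
  rw [Finset.card_eq_sum_ones, ← sum_range_minimalPeriod_perm σ (fun _ => 1), Finset.sum_const,
    Finset.card_range, smul_eq_mul, mul_one]

/-- The set of cycles of a permutation, fixed points included. -/
abbrev CycleClass (σ : Perm α) : Type _ := Quotient (Perm.SameCycle.setoid σ)

theorem filter_cycleClass_mk_eq (σ : Perm α) [DecidableEq (CycleClass σ)]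
    [DecidableRel σ.SameCycle] (T : Finset α) (x : α) :
    {y ∈ T | (⟦y⟧ : CycleClass σ) = ⟦x⟧} = {y ∈ T | σ.SameCycle x y} := by
  refine Finset.filter_congr fun y _ => ?_
  rw [Quotient.eq]
  exact Perm.sameCycle_comm

theorem exists_common_cycle_transversal [Finite α] {σ τ : Perm α} [DecidableRel σ.SameCycle]
    [DecidableRel τ.SameCycle] {d : ℕ} (hd : d ≠ 0) (hσ : ∀ x, minimalPeriod σ x = d)
    (hτ : ∀ x, minimalPeriod τ x = d) :
    ∃ T : Finset α, (∀ x, #{y ∈ T | σ.SameCycle x y} = 1) ∧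
      ∀ x, #{y ∈ T | τ.SameCycle x y} = 1 := by
  have := Fintype.ofFinite α
  have card_fiber (ρ : Perm α) [DecidableEq (CycleClass ρ)] [DecidableRel ρ.SameCycle]
      (hρ : ∀ x, minimalPeriod ρ x = d) (b : CycleClass ρ) :
      #{y : α | (⟦y⟧ : CycleClass ρ) = b} = d := by
    induction b using Quotient.inductionOn with
    | h x => rw [filter_cycleClass_mk_eq, card_filter_sameCycle_eq_minimalPeriod, hρ]
  have := Classical.decEq (CycleClass σ)
  have := Classical.decEq (CycleClass τ)
  obtain ⟨T, hT, hT'⟩ := exists_common_transversal hd (card_fiber σ hσ) (card_fiber τ hτ)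
  refine ⟨T, fun x => ?_, fun x => ?_⟩
  · rw [← filter_cycleClass_mk_eq, hT]
  · rw [← filter_cycleClass_mk_eq, hT']

theorem card_filter_range_pow_apply_mem [Finite α] [DecidableEq α] {σ : Perm α} {c d : ℕ}
    [DecidableRel (σ ^ c).SameCycle] (hσ : ∀ x, minimalPeriod ⇑(σ ^ c) x = d) {T : Finset α}
    (hT : ∀ x, #{y ∈ T | (σ ^ c).SameCycle x y} = 1) (x : α) :
    #{j ∈ Finset.range (c * d) | (σ ^ j) x ∈ T} = c := by
  have := Fintype.ofFinite α
  have block (s : ℕ) :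
      ∑ r ∈ Finset.range d, (if (σ ^ (c * r + s)) x ∈ T then 1 else 0) = 1 := by
    simp only [pow_add, pow_mul, Perm.mul_apply]
    rw [← hσ ((σ ^ s) x), sum_range_minimalPeriod_perm (σ ^ c) fun y => if y ∈ T then 1 else 0,
      ← Finset.card_filter, Finset.filter_filter, ← hT ((σ ^ s) x)]
    congr 1
    ext y
    simp [and_comm]
  rw [Finset.card_filter, sum_range_mul_eq_sum_sum, Finset.sum_congr rfl fun s _ => block s]
  simp

/-- The properties of the permutation `σ` that an `n`-th root `y` of a permutation `g` induces on
the set of cycles of `g`, where `period` is the length of a cycle. The last one holds because, if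
`y ^ l` stabilises a cycle, then it acts there as a power `g ^ t`, so that `n = l * k` forces
`t * k ≡ 1` modulo the length of that cycle. -/
structure IsRootAction (n : ℕ) (period : α → ℕ) (σ : Perm α) : Prop where
  pow_eq_one : σ ^ n = 1
  period_apply (x : α) : period (σ x) = period x
  coprime_period {x : α} {l k : ℕ} : n = l * k → (σ ^ l) x = x → k.Coprime (period x)

namespace IsRootAction

variable {n : ℕ} {period : α → ℕ} {σ τ : Perm α}

theorem period_pow_apply (h : IsRootAction n period σ) (j : ℕ) (x : α) :
    period ((σ ^ j) x) = period x := by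
  induction j with
  | zero => rfl
  | succ j ih => rw [pow_succ', Perm.mul_apply, h.period_apply, ih]

theorem minimalPeriod_pow_eq {c d : ℕ} (h : IsRootAction (c * d) period σ) (x : α)
    (hd : ∀ k, k ∣ d → k.Coprime (period x) → k = 1) : minimalPeriod ⇑(σ ^ c) x = d := by
  have isPeriodicPt : IsPeriodicPt ⇑(σ ^ c) d x := by
    rw [IsPeriodicPt, IsFixedPt, Perm.iterate_eq_pow, ← pow_mul, h.pow_eq_one, Perm.one_apply]
  obtain ⟨k, hk⟩ := isPeriodicPt.minimalPeriod_dvd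
  have fixed : (σ ^ (c * minimalPeriod ⇑(σ ^ c) x)) x = x := by
    rw [pow_mul, ← Perm.iterate_eq_pow]
    exact iterate_minimalPeriod
  have coprime := h.coprime_period (k := k) (by rw [mul_assoc, ← hk]) fixed
  rw [hd k (Dvd.intro_left _ hk.symm) coprime, mul_one] at hk
  exact hk.symm

theorem exists_sum_modEq_of_period_eq [Finite α] (hσ : IsRootAction n period σ)
    (hτ : IsRootAction n period τ) (hn : n ≠ 0) {m i : ℕ} (hm : m.Coprime i)
    (hi : ∀ x, period x = i) :
    ∃ γ : α → ℤ, ∀ x, 1 + ∑ j ∈ Finset.range n, 2 * γ ((σ ^ j) x) ≡ m [ZMOD i] ∧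
      1 + ∑ j ∈ Finset.range n, 2 * γ ((τ ^ j) x) ≡ m [ZMOD i] := by
  classical
  have := Fintype.ofFinite α
  obtain ⟨c, d, rfl, coprime, hd⟩ := exists_mul_eq_coprime hn i
  have minimalPeriod_eq {ρ : Perm α} (hρ : IsRootAction (c * d) period ρ) (x : α) :
      minimalPeriod ⇑(ρ ^ c) x = d := hρ.minimalPeriod_pow_eq x fun k => hi x ▸ hd k
  obtain ⟨T, hTσ, hTτ⟩ := exists_common_cycle_transversal (right_ne_zero_of_mul hn)
    (minimalPeriod_eq hσ) (minimalPeriod_eq hτ)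
  obtain ⟨u, hu⟩ := exists_one_add_mul_two_mul_modEq coprime hm
  have sum_eq {ρ : Perm α} {x : α} (h : #{j ∈ Finset.range (c * d) | (ρ ^ j) x ∈ T} = c) :
      ∑ j ∈ Finset.range (c * d), 2 * (if (ρ ^ j) x ∈ T then u else 0) = c * (2 * u) := by
    rw [← Finset.mul_sum, ← Finset.sum_filter, Finset.sum_const, h, nsmul_eq_mul, mul_left_comm]
  refine ⟨fun x => if x ∈ T then u else 0, fun x => ⟨?_, ?_⟩⟩
  · rwa [sum_eq (card_filter_range_pow_apply_mem (minimalPeriod_eq hσ) hTσ x)]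
  · rwa [sum_eq (card_filter_range_pow_apply_mem (minimalPeriod_eq hτ) hTτ x)]

theorem subtypePerm (h : IsRootAction n period σ) (i : ℕ) :
    IsRootAction n (fun x : {x // period x = i} => period x)
      (σ.subtypePerm fun x => by rw [h.period_apply]) where
  pow_eq_one := by
    ext x
    simp [Perm.subtypePerm_pow, h.pow_eq_one]
  period_apply x := h.period_apply x
  coprime_period {x l k} hn hx := h.coprime_period hn (by
    simpa [Perm.subtypePerm_pow, Subtype.ext_iff] using hx)

theorem exists_sum_modEq [Finite α] (hσ : IsRootAction n period σ) (hτ : IsRootAction n period τ)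
    (hn : n ≠ 0) {m : ℕ} (hm : ∀ x, m.Coprime (period x)) :
    ∃ γ : α → ℤ, ∀ x, 1 + ∑ j ∈ Finset.range n, 2 * γ ((σ ^ j) x) ≡ m [ZMOD period x] ∧
      1 + ∑ j ∈ Finset.range n, 2 * γ ((τ ^ j) x) ≡ m [ZMOD period x] := by
  have exists_on (i : ℕ) (hi : m.Coprime i) := exists_sum_modEq_of_period_eq
    (hσ.subtypePerm i) (hτ.subtypePerm i) hn hi fun x => x.2
  choose γ hγ using exists_on
  have γ_congr {i : ℕ} (hi : m.Coprime i) {y : α} (h : period y = i) :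
      γ (period y) (hm y) ⟨y, rfl⟩ = γ i hi ⟨y, h⟩ := by
    subst h
    rfl
  refine ⟨fun x => γ (period x) (hm x) ⟨x, rfl⟩, fun x => ?_⟩
  have h := hγ (period x) (hm x) ⟨x, rfl⟩
  simp only [Perm.subtypePerm_pow, Perm.subtypePerm_apply] at h
  simpa only [γ_congr (hm x) (hσ.period_pow_apply _ x), γ_congr (hm x) (hτ.period_pow_apply _ x)]
    using h

end IsRootAction
end CycleTransversals

section Twists

open Function Equiv

variable {α : Type*} {g y : Perm α} {σ : Perm (CycleClass g)}

theorem cycleClass_mk_zpow_apply (g : Perm α) (k : ℤ) (x : α) :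
    (⟦(g ^ k) x⟧ : CycleClass g) = ⟦x⟧ :=
  Quotient.sound (Perm.SameCycle.refl g x).zpow_left

/-- The permutation that acts on each cycle `c` of `g` as the power `g ^ β c`. -/
def twist (g : Perm α) (β : CycleClass g → ℤ) : Perm α where
  toFun x := (g ^ β ⟦x⟧) x
  invFun x := (g ^ (-β ⟦x⟧)) x
  left_inv x := by simp [cycleClass_mk_zpow_apply]
  right_inv x := by simp [cycleClass_mk_zpow_apply, ← Perm.mul_apply, ← zpow_add, -zpow_neg]

theorem twist_apply (g : Perm α) (β : CycleClass g → ℤ) (x : α) :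
    twist g β x = (g ^ β ⟦x⟧) x := rfl

theorem cycleClass_mk_twist_apply (g : Perm α) (β : CycleClass g → ℤ) (x : α) :
    (⟦twist g β x⟧ : CycleClass g) = ⟦x⟧ :=
  cycleClass_mk_zpow_apply g _ x

theorem twist_two_mul (g : Perm α) (γ : CycleClass g → ℤ) :
    twist g (fun c => 2 * γ c) = twist g γ ^ 2 := by
  ext x
  rw [sq, Perm.mul_apply, twist_apply g γ (twist g γ x), cycleClass_mk_twist_apply, twist_apply,
    twist_apply, two_mul, zpow_add, Perm.mul_apply]

theorem exists_semiconj_cycleClass_mk (h : Commute y g) :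
    ∃ σ : Perm (CycleClass g), Semiconj (fun x => (⟦x⟧ : CycleClass g)) y σ := by
  refine ⟨Quotient.congr y fun x x' => ?_, fun x => rfl⟩
  have apply_zpow (k : ℤ) : (g ^ k) (y x) = y ((g ^ k) x) := by
    rw [← Perm.mul_apply, ← (h.zpow_right k).eq, Perm.mul_apply]
  exact exists_congr fun k => by rw [apply_zpow, y.injective.eq_iff]

theorem cycleClass_mk_pow_apply (h : Semiconj (fun x => (⟦x⟧ : CycleClass g)) y σ) (j : ℕ) (x : α) :
    (⟦(y ^ j) x⟧ : CycleClass g) = (σ ^ j) ⟦x⟧ := by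
  rw [← Perm.iterate_eq_pow, ← Perm.iterate_eq_pow]
  exact (h.iterate_right j).eq x

theorem mul_twist_pow_apply (hy : Commute y g)
    (h : Semiconj (fun x => (⟦x⟧ : CycleClass g)) y σ) (β : CycleClass g → ℤ) (k : ℕ) (x : α) :
    ((y * twist g β) ^ k) x = (g ^ ∑ j ∈ Finset.range k, β ((σ ^ j) ⟦x⟧)) ((y ^ k) x) := by
  induction k with
  | zero => simp
  | succ k ih =>
    rw [pow_succ', Perm.mul_apply, ih, Perm.mul_apply, twist_apply, cycleClass_mk_zpow_apply,
      cycleClass_mk_pow_apply h, ← Perm.mul_apply (g ^ _) (g ^ _), ← zpow_add,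
      ← Finset.sum_range_succ_comm fun j => β ((σ ^ j) ⟦x⟧), ← Perm.mul_apply y,
      (hy.zpow_right _).eq, Perm.mul_apply, ← Perm.mul_apply y, ← pow_succ']

theorem minimalPeriod_apply_of_commute (h : Commute y g) (x : α) :
    minimalPeriod g (y x) = minimalPeriod g x := by
  refine minimalPeriod_eq_minimalPeriod_iff.2 fun k => ?_
  rw [IsPeriodicPt, IsPeriodicPt, IsFixedPt, IsFixedPt, Perm.iterate_eq_pow,
    ← Perm.mul_apply, ← (h.pow_right k).eq, Perm.mul_apply, y.injective.eq_iff]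

theorem zpow_apply_eq_zpow_apply_iff {x : α} {k l : ℤ} :
    (g ^ k) x = (g ^ l) x ↔ k ≡ l [ZMOD minimalPeriod g x] := by
  rw [Int.modEq_comm, Int.modEq_iff_dvd]
  refine Iff.trans ?_ (MulAction.zpow_smul_eq_iff_minimalPeriod_dvd (a := g) (b := x))
  rw [sub_eq_neg_add, zpow_add, Perm.smul_def, Perm.mul_apply, zpow_neg, Perm.inv_eq_iff_eq]

theorem pow_apply_eq_zpow_mul_apply (h : Commute y g) {x : α} {t : ℤ} (hx : y x = (g ^ t) x)
    (k : ℕ) : (y ^ k) x = (g ^ (t * k)) x := by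
  induction k with
  | zero => simp
  | succ k ih =>
    rw [pow_succ', Perm.mul_apply, ih, ← Perm.mul_apply, (h.zpow_right _).eq, Perm.mul_apply, hx,
      ← Perm.mul_apply, ← zpow_add, Nat.cast_succ, mul_add_one]

/-- The length of a cycle of `g`. -/
noncomputable def cycleLength (g : Perm α) : CycleClass g → ℕ :=
  Quotient.lift (minimalPeriod g) fun x _ ⟨k, hk⟩ =>
    hk ▸ (minimalPeriod_apply_of_commute (Commute.zpow_self g k) x).symm

theorem cycleLength_mk (g : Perm α) (x : α) : cycleLength g ⟦x⟧ = minimalPeriod g x := rfl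

theorem isRootAction_of_pow_eq {n : ℕ} (hy : y ^ n = g)
    (h : Semiconj (fun x => (⟦x⟧ : CycleClass g)) y σ) : IsRootAction n (cycleLength g) σ where
  pow_eq_one := by
    ext c
    induction c using Quotient.inductionOn with
    | h x =>
      rw [← cycleClass_mk_pow_apply h, hy, Perm.one_apply]
      simpa only [zpow_one] using cycleClass_mk_zpow_apply g 1 x
  period_apply c := by
    induction c using Quotient.inductionOn with
    | h x =>
      rw [← h.eq x]
      exact minimalPeriod_apply_of_commute (hy ▸ Commute.self_pow y n) x
  coprime_period {c l k} hn hc := by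
    induction c using Quotient.inductionOn with
    | h x =>
      rw [← cycleClass_mk_pow_apply h, Quotient.eq] at hc
      obtain ⟨t, ht⟩ := Perm.SameCycle.symm hc
      have pow_apply : ((y ^ l) ^ k) x = (g ^ (t * k)) x :=
        pow_apply_eq_zpow_mul_apply ((hy ▸ Commute.self_pow y n : Commute y g).pow_left l) ht.symm k
      rw [← pow_mul, ← hn, hy] at pow_apply
      have modEq : t * k ≡ 1 [ZMOD minimalPeriod g x] :=
        zpow_apply_eq_zpow_apply_iff.1 (by rw [← pow_apply, zpow_one])
      obtain ⟨s, hs⟩ := Int.modEq_iff_dvd.1 modEq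
      exact Nat.isCoprime_iff_coprime.1 ⟨t, s, by rw [cycleLength_mk]; linarith⟩

theorem mul_twist_pow_eq {n m : ℕ} (hy : y ^ n = g)
    (h : Semiconj (fun x => (⟦x⟧ : CycleClass g)) y σ) {β : CycleClass g → ℤ}
    (hβ : ∀ c, 1 + ∑ j ∈ Finset.range n, β ((σ ^ j) c) ≡ m [ZMOD cycleLength g c]) :
    (y * twist g β) ^ n = g ^ m := by
  ext x
  rw [mul_twist_pow_apply (hy ▸ Commute.self_pow y n) h, hy, ← Perm.mul_apply, ← zpow_add_one,
    add_comm, ← zpow_natCast]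
  exact zpow_apply_eq_zpow_apply_iff.2 (hβ ⟦x⟧)

end Twists

section Squares

open Function Equiv

variable {α : Type*}

theorem minimalPeriod_dvd_orderOf (g : Perm α) (x : α) : minimalPeriod g x ∣ orderOf g := by
  refine IsPeriodicPt.minimalPeriod_dvd ?_
  rw [IsPeriodicPt, IsFixedPt, Perm.iterate_eq_pow, pow_orderOf_eq_one, Perm.one_apply]

/-- The exponents of the twist can be chosen to depend only on the permutation of the cycles of `g`
induced by the common root; this makes the map `y ↦ y * twist g γ ^ 2` injective. -/
theorem exists_mul_twist_sq_mem_commonRoots [Finite α] {n m : ℕ} (hn : n ≠ 0) {a g : Perm α}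
    (hm : m.Coprime (orderOf g)) (σ : Perm (CycleClass g)) :
    ∃ γ : CycleClass g → ℤ, ∀ y ∈ commonRoots n a g,
      Semiconj (fun x => (⟦x⟧ : CycleClass g)) y σ →
        y * twist g γ ^ 2 ∈ commonRoots n a (g ^ m) := by
  by_cases h : ∃ y ∈ commonRoots n a g, Semiconj (fun x => (⟦x⟧ : CycleClass g)) y σ
  · obtain ⟨y, hy, hyσ⟩ := h
    obtain ⟨τ, hτ⟩ := exists_semiconj_cycleClass_mk (commute_of_mem_commonRoots hy)
    have coprime (c : CycleClass g) : m.Coprime (cycleLength g c) := by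
      induction c using Quotient.inductionOn with
      | h x => exact hm.coprime_dvd_right (minimalPeriod_dvd_orderOf g x)
    obtain ⟨γ, hγ⟩ := (isRootAction_of_pow_eq hy.1 hyσ).exists_sum_modEq
      (isRootAction_of_pow_eq hy.2 (σ := τ * σ) (hτ.comp_right hyσ)) hn coprime
    refine ⟨γ, fun z hz hzσ => ?_⟩
    rw [← twist_two_mul]
    refine ⟨mul_twist_pow_eq hz.1 hzσ fun c => (hγ c).1, ?_⟩
    rw [← mul_assoc]
    exact mul_twist_pow_eq hz.2 (σ := τ * σ) (hτ.comp_right hzσ) fun c => (hγ c).2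
  · exact ⟨0, fun y hy hyσ => absurd ⟨y, hy, hyσ⟩ h⟩

theorem semiconj_mul_twist_sq {g y : Perm α} {σ : Perm (CycleClass g)} (γ : CycleClass g → ℤ)
    (h : Semiconj (fun x => (⟦x⟧ : CycleClass g)) y σ) :
    Semiconj (fun x => (⟦x⟧ : CycleClass g)) ⇑(y * twist g γ ^ 2) σ := by
  rw [← twist_two_mul]
  exact h.comp_right (gb' := id) (cycleClass_mk_twist_apply g _)

theorem coe_mem_commonRoots_iff {G : Type*} [Group G] {H : Subgroup G} {n : ℕ} {a g y : H} :
    (y : G) ∈ commonRoots n (a : G) g ↔ y ∈ commonRoots n a g := by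
  simp [commonRoots, Subtype.ext_iff]

theorem ncard_commonRoots_le_pow [Finite α] {H : Subgroup (Perm α)} (hH : ∀ σ : Perm α, σ ^ 2 ∈ H)
    {n m : ℕ} (hn : n ≠ 0) (a g : H) (hm : m.Coprime (orderOf g)) :
    (commonRoots n a g).ncard ≤ (commonRoots n a (g ^ m)).ncard := by
  rw [← Subgroup.orderOf_coe] at hm
  choose γ hγ using exists_mul_twist_sq_mem_commonRoots hn (a := a) hm
  have commute (y : H) (hy : y ∈ commonRoots n a g) : Commute (y : Perm α) g :=
    (coe_mem_commonRoots_iff.2 hy).1 ▸ Commute.self_pow (y : Perm α) n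
  choose! σ hσ using fun y hy => exists_semiconj_cycleClass_mk (commute y hy)
  refine Set.ncard_le_ncard_of_injOn (fun y => y * ⟨twist (g : Perm α) (γ (σ y)) ^ 2, hH _⟩) ?_ ?_
  · intro y hy
    exact coe_mem_commonRoots_iff.1 (hγ (σ y) y (coe_mem_commonRoots_iff.2 hy) (hσ y hy))
  · intro y hy y' hy' h
    have σ_eq : σ y = σ y' := by
      ext ⟨x⟩
      refine (semiconj_mul_twist_sq (γ (σ y)) (hσ y hy) x).symm.trans (Eq.trans ?_
        (semiconj_mul_twist_sq (γ (σ y')) (hσ y' hy') x))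
      exact congrArg (fun z : H => (⟦(z : Perm α) x⟧ : CycleClass (g : Perm α))) h
    simp only [σ_eq] at h
    exact mul_right_cancel h

end Squares

theorem mainTheorem8_general {α : Type*} [Finite α] {H : Subgroup (Equiv.Perm α)} [Fintype H]
    [DecidableEq H] (hH : ∀ σ : Equiv.Perm α, σ ^ 2 ∈ H) : IsFSZ H := fun _ hn =>
  DrinfeldDouble.isFSZn_of_ncard_commonRoots_le hn.ne' fun a g _ hm =>
    ncard_commonRoots_le_pow hH hn.ne' a g (hm.coprime_dvd_right orderOf_dvd_card)

theorem mainTheorem8 (N : ℕ) : IsFSZ (alternatingGroup (Fin N)) := by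
  refine mainTheorem8_general fun σ => ?_
  rw [Equiv.Perm.mem_alternatingGroup, map_pow, Int.units_sq]
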